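/- Let $\tau$ be a random variable with values in the extended reals ($\tau=\infty$ may have positive probability) whose cumulative distribution function $F_\tau(t)=\mathbb{P}(\tau\le t)$ satisfies $F_\tau(0)=0$ and $F_\tau(t)>0$ for some $t\in(0,\infty)$. Let $Y$ be an exponential random variable with unit mean, independent of $\tau$, and for $r>0$ let $\sigma=Y/r$ be the resetting time (so that resetting is exponential with rate $r$). Let $$p=p(r)=\mathbb{P}(\tau<\sigma),$$ and let $T=T(r)$ be the first passage time under resetting, i.e. a random variable of the form $$T=\sum_{n=1}^{R}\sigma_n^-+\tau^-,$$ where $R,\sigma_1^-,\sigma_2^-,\dots,\tau^-$ are independent, $\mathbb{P}(R=n)=(1-p)^n p$ for $n\in\{0,1,2,\dots\}$, $\mathbb{P}(\sigma_n^->t)=\mathbb{P}(\sigma>t\mid\sigma<\tau)$ for all $n\ge1$, and $\mathbb{P}(\tau^->t)=\mathbb{P}(\tau>t\mid\tau<\sigma)$. Write $f\sim g$ if $f/g\to1$. If $F_\tau(t)\sim At^b$ as $t\to0^+$ for some constants $A>0$ and $b>0$, then $$p\sim\Gamma(b+1)\,A\,r^{-b}\quad\text{as }r\to\infty,$$ and,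 for every integer $m\ge1$, the moment $\mathbb{E}[T^m]$ is finite for all sufficiently large $r$ and $$\mathbb{E}[T^m]\sim m!\left(\frac{1}{A\,\Gamma(b+1)}\,r^{b-1}\right)^m\quad\text{as }r\to\infty,$$ where $\Gamma(\beta)=\int_0^\infty z^{\beta-1}e^{-z}\,dz$ is the gamma function. -/

import Mathlib

open MeasureTheory ProbabilityTheory Filter Topology Asymptotics
open scoped Nat

/-- The cumulative distribution function `F_τ(t) = ℙ(τ ≤ t)`, `t ∈ ℝ`, of a random time `τ` that is
allowed to be infinite with positive probability. -/
noncomputable def distFun {Ω : Type*} [MeasurableSpace Ω] (P : Measure Ω) (τ : Ω → EReal)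
    (t : ℝ) : ℝ :=
  P.real {ω | τ ω ≤ (t : EReal)}

/-- The resetting time `σ = Y / r` with resetting rate `r`. -/
noncomputable def resetTime {Ω : Type*} (Y : Ω → ℝ) (r : ℝ) : Ω → ℝ :=
  fun ω => Y ω / r

/-- The event `{τ < σ}` that the search succeeds before the reset. -/
def successEvent {Ω : Type*} (τ : Ω → EReal) (σ : Ω → ℝ) : Set Ω :=
  {ω | τ ω < (σ ω : EReal)}

/-- The event `{σ < τ}` that the reset happens before the search succeeds. -/
def resetEvent {Ω : Type*} (τ : Ω → EReal) (σ : Ω → ℝ) : Set Ω :=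
  {ω | (σ ω : EReal) < τ ω}

/-- The probability `p = ℙ(τ < σ)` of a successful search prior to resetting. -/
noncomputable def successProb {Ω : Type*} [MeasurableSpace Ω] (P : Measure Ω)
    (τ : Ω → EReal) (σ : Ω → ℝ) : ℝ :=
  P.real (successEvent τ σ)

/-- `T`, a random variable on `(Ω', Q)`, is a first passage time under resetting, for the search
time `τ` and the resetting time `σ` on `(Ω, P)`: almost surely
`T = σ₁⁻ + ⋯ + σ_R⁻ + τ⁻` (the variable `σ⁻ n` below is the `(n+1)`-st one), where
* `R` is geometric on `{0, 1, …}` with success probability `p = ℙ(τ < σ)`,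
* every `σ⁻ n` has survival probability `ℙ(σ > t ∣ σ < τ)`,
* `τ⁻` has survival probability `ℙ(τ > t ∣ τ < σ)`,
* `R`, `σ⁻ 0`, `σ⁻ 1`, …, `τ⁻` are mutually independent. -/
structure IsResetFPT {Ω Ω' : Type*} [MeasurableSpace Ω] [MeasurableSpace Ω'] (P : Measure Ω)
    (τ : Ω → EReal) (σ : Ω → ℝ) (Q : Measure Ω') (T : Ω' → ℝ) : Prop where
  exists_decomposition : ∃ (R : Ω' → ℕ) (σm : ℕ → Ω' → ℝ) (τm : Ω' → ℝ),
    Measurable R ∧ (∀ n, Measurable (σm n)) ∧ Measurable τm ∧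
    (∀ n : ℕ, Q.real {ω | R ω = n} =
      (1 - successProb P τ σ) ^ n * successProb P τ σ) ∧
    (∀ (n : ℕ) (t : ℝ), Q.real {ω | t < σm n ω} =
      (P[|resetEvent τ σ]).real {ω | t < σ ω}) ∧
    (∀ t : ℝ, Q.real {ω | t < τm ω} =
      (P[|successEvent τ σ]).real {ω | (t : EReal) < τ ω}) ∧
    iIndepFun σm Q ∧
    IndepFun (fun ω n => σm n ω) τm Q ∧
    IndepFun R (fun ω => ((fun n => σm n ω), τm ω)) Q ∧
    ∀ᵐ ω ∂Q, T ω = (∑ n ∈ Finset.range (R ω), σm n ω) + τm ω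

/-! The success probability is `p = E[F_τ(Y/r)]`. For large `r` only the behaviour of `F_τ` at `0`
matters: `r^b F_τ(y/r) → A y^b` with a dominating function `C y^b`, so `r^b p → A ∫ y^b e^{-y} dy =
A Γ(b+1)` (`tendsto_rpow_mul_successProb`).

For the moments, adding one summand to the random walk and expanding binomially gives a recursion in
the number of summands. Weighting by the geometric law of `R` turns it into a renewal identity
(`IsResetFPT.moments`) `p E[T^m] = p E[(τ⁻)^m] + (1-p) ∑_{j<m} C(m,j) E[(σ⁻)^{m-j}] E[T^j]`, and the
same induction gives finiteness. Set `B_m = (p r)^m E[T^m]` and multiply the identity by `p^{m-1}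
r^m`. Resets become almost certain, so `r^k E[(σ⁻)^k] → E[Y^k] = k!`
(`tendsto_pow_mul_integral_resetTime`). The delay is negligible because `r τ ≤ Y` on success
(`tendsto_mul_pow_mul_integral_toReal`). The `j`-th term carries a factor `p^{m-1-j}`, so only `j =
m-1` survives and `B_m` has limit `m · lim B_{m-1} = m!` (`tendsto_factorial_of_recursion`).
Dividing by `(p r)^m` gives the claim. -/

/-! ### Generating sums and independence -/

/-- Generating sums of sequences related by a first order recursion. -/
lemma summable_geometric_mul_of_recursion {q : ℝ} (hq0 : 0 ≤ q) (hq1 : q < 1) {g h : ℕ → ℝ}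
    (hg : ∀ n, 0 ≤ g n) (hh : ∀ n, 0 ≤ h n) (hrec : ∀ n, g (n + 1) = g n + h n)
    (hs : Summable fun n => q ^ n * h n) :
    Summable (fun n => q ^ n * g n) ∧
      (1 - q) * ∑' n, q ^ n * g n = g 0 + q * ∑' n, q ^ n * h n := by
  set H := ∑' n, q ^ n * h n with hH
  have hstep : ∀ N, ∑ n ∈ Finset.range (N + 1), q ^ n * g n =
      g 0 + q * (∑ n ∈ Finset.range N, q ^ n * g n + ∑ n ∈ Finset.range N, q ^ n * h n) := by
    intro N
    rw [Finset.sum_range_succ', ← Finset.sum_add_distrib, Finset.mul_sum, add_comm]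
    congr 1
    · simp
    · refine Finset.sum_congr rfl fun n _ => ?_
      rw [hrec]; ring
  have hpart : ∀ N, ∑ n ∈ Finset.range N, q ^ n * h n ≤ H := fun N =>
    hs.sum_le_tsum _ fun n _ => mul_nonneg (pow_nonneg hq0 n) (hh n)
  have hH0 : 0 ≤ H := tsum_nonneg fun n => mul_nonneg (pow_nonneg hq0 n) (hh n)
  have h1q : 0 < 1 - q := by linarith
  -- The bound is the fixed point of `x ↦ g 0 + q (x + H)`, the map that controls one step of the
  -- partial sums.
  have hbound : ∀ N, ∑ n ∈ Finset.range N, q ^ n * g n ≤ (g 0 + q * H) / (1 - q) := by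
    intro N
    induction N with
    | zero => simpa using div_nonneg (add_nonneg (hg 0) (mul_nonneg hq0 hH0)) h1q.le
    | succ N ih =>
      rw [hstep, le_div_iff₀ h1q]
      rw [le_div_iff₀ h1q] at ih
      nlinarith [mul_le_mul_of_nonneg_left (hpart N) (mul_nonneg hq0 h1q.le),
        mul_le_mul_of_nonneg_left ih hq0]
  have hsum : Summable (fun n => q ^ n * g n) :=
    summable_of_sum_range_le (fun n => mul_nonneg (pow_nonneg hq0 n) (hg n)) hbound
  refine ⟨hsum, ?_⟩
  have := hsum.tsum_eq_zero_add
  have h2 : ∀ n, q ^ (n + 1) * g (n + 1) = q * (q ^ n * g n) + q * (q ^ n * h n) := by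
    intro n; rw [hrec]; ring
  simp_rw [h2] at this
  rw [(hsum.mul_left q).tsum_add (hs.mul_left q), tsum_mul_left, tsum_mul_left] at this
  simp only [pow_zero, one_mul] at this
  linarith

/-- The generating sums of the moments of a random walk, from the binomial recursion. -/
lemma summable_geometric_mul_of_binomial_recursion {q : ℝ} (hq0 : 0 ≤ q) (hq1 : q < 1)
    {f : ℕ → ℕ → ℝ} {s : ℕ → ℝ} (hf : ∀ m n, 0 ≤ f m n) (hs : ∀ k, 0 ≤ s k) (hs0 : s 0 = 1)
    (hrec : ∀ m n, f m (n + 1) =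
      ∑ j ∈ Finset.range (m + 1), (m.choose j : ℝ) * (f j n * s (m - j))) (m : ℕ) :
    Summable (fun n => q ^ n * f m n) ∧
      (1 - q) * ∑' n, q ^ n * f m n = f m 0 +
        q * ∑ j ∈ Finset.range m, (m.choose j : ℝ) * s (m - j) * ∑' n, q ^ n * f j n := by
  induction m using Nat.strong_induction_on with
  | _ m ih =>
    -- The top term `j = m` of the recursion is `f m n` itself because `s 0 = 1`; `h` collects the
    -- lower moments, already handled by induction.
    set h : ℕ → ℝ := fun n => ∑ j ∈ Finset.range m, (m.choose j : ℝ) * (f j n * s (m - j)) with hh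
    have hterm : ∀ n, q ^ n * h n =
        ∑ j ∈ Finset.range m, (m.choose j : ℝ) * s (m - j) * (q ^ n * f j n) := by
      intro n
      rw [hh, Finset.mul_sum]
      exact Finset.sum_congr rfl fun j _ => by ring
    have hsumj : ∀ j ∈ Finset.range m,
        Summable fun n => (m.choose j : ℝ) * s (m - j) * (q ^ n * f j n) := fun j hj =>
      ((ih j (Finset.mem_range.1 hj)).1).mul_left _
    have hsum : Summable fun n => q ^ n * h n := by
      simp_rw [hterm]
      exact summable_sum hsumj
    have := summable_geometric_mul_of_recursion hq0 hq1 (g := f m) (h := h) (hf m)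
      (fun n => Finset.sum_nonneg fun j _ => by have := hf j n; have := hs (m - j); positivity)
      (fun n => by rw [hrec, Finset.sum_range_succ, hh]; simp [hs0, add_comm]) hsum
    refine ⟨this.1, this.2.trans ?_⟩
    congr 2
    simp_rw [hterm]
    rw [Summable.tsum_finsetSum hsumj]
    exact Finset.sum_congr rfl fun j _ => tsum_mul_left

/-- If `X`, `Z` are independent and `(X, Z)` is independent of `U`, then `X + U` is independent
of `Z`. -/
lemma ProbabilityTheory.IndepFun.add_left_of_prodMk {Ω : Type*} [MeasurableSpace Ω]
    {μ : Measure Ω} [IsProbabilityMeasure μ] {X Z U : Ω → ℝ} (hX : Measurable X)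
    (hZ : Measurable Z) (hU : Measurable U) (hXZ : IndepFun X Z μ)
    (hXZU : IndepFun (fun ω => (X ω, Z ω)) U μ) : IndepFun (fun ω => X ω + U ω) Z μ := by
  have hXU : IndepFun X U μ := hXZU.comp (measurable_fst : Measurable (Prod.fst : ℝ × ℝ → ℝ)) measurable_id
  have := Measure.isProbabilityMeasure_map (μ := μ) hX.aemeasurable
  have := Measure.isProbabilityMeasure_map (μ := μ) hZ.aemeasurable
  have := Measure.isProbabilityMeasure_map (μ := μ) hU.aemeasurable
  have h1 := (indepFun_iff_map_prod_eq_prod_map_map hX.aemeasurable hZ.aemeasurable).1 hXZ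
  have h2 := (indepFun_iff_map_prod_eq_prod_map_map (hX.prodMk hZ).aemeasurable
    hU.aemeasurable).1 hXZU
  have h3 := (indepFun_iff_map_prod_eq_prod_map_map hX.aemeasurable hU.aemeasurable).1 hXU
  rw [h1] at h2
  rw [indepFun_iff_measure_inter_preimage_eq_mul]
  intro S t hS ht
  have hS' : MeasurableSet {y : ℝ × ℝ | y.1 + y.2 ∈ S} :=
    (measurable_fst.add measurable_snd) hS
  have hB : MeasurableSet {y : (ℝ × ℝ) × ℝ | y.1.1 + y.2 ∈ S ∧ y.1.2 ∈ t} :=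
    ((by fun_prop : Measurable fun y : (ℝ × ℝ) × ℝ => y.1.1 + y.2) hS).inter
      ((by fun_prop : Measurable fun y : (ℝ × ℝ) × ℝ => y.1.2) ht)
  have e1 : μ ((fun ω => X ω + U ω) ⁻¹' S ∩ Z ⁻¹' t) =
      μ.map (fun ω => ((X ω, Z ω), U ω)) {y | y.1.1 + y.2 ∈ S ∧ y.1.2 ∈ t} := by
    rw [Measure.map_apply ((hX.prodMk hZ).prodMk hU) hB]; rfl
  have e2 : μ ((fun ω => X ω + U ω) ⁻¹' S) =
      μ.map (fun ω => (X ω, U ω)) {y | y.1 + y.2 ∈ S} := by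
    rw [Measure.map_apply (hX.prodMk hU) hS']; rfl
  -- Fubini over the value `c` of `U`: each section is the rectangle `{x + c ∈ S} × t`, whose
  -- measure factors.
  rw [e1, e2, h2, h3, Measure.prod_apply_symm hB, Measure.prod_apply_symm hS',
    ← Measure.map_apply hZ ht, ← lintegral_mul_const']
  · refine lintegral_congr fun c => ?_
    rw [← Measure.prod_prod]; rfl
  · exact measure_ne_top _ _

/-! ### Moments of a geometric random sum -/

section RandomSum

variable {Ω : Type*} [MeasurableSpace Ω] {μ : Measure Ω}
  {X : ℕ → Ω → ℝ} {U : Ω → ℝ}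

lemma indepFun_sum_range_add [IsProbabilityMeasure μ] (hX : ∀ n, Measurable (X n)) (hU : Measurable U)
    (hindX : iIndepFun X μ) (hindU : IndepFun (fun ω n => X n ω) U μ) (n : ℕ) :
    IndepFun (fun ω => (∑ k ∈ Finset.range n, X k ω) + U ω) (X n) μ := by
  refine IndepFun.add_left_of_prodMk (Finset.measurable_fun_sum _ fun k _ => hX k) (hX n) hU ?_ ?_
  · have := hindX.indepFun_finsetSum_of_notMem hX (s := Finset.range n) (i := n) (by simp)
    convert this using 1
    ext ω; simp
  · exact hindU.comp (show Measurable fun x : ℕ → ℝ => (∑ k ∈ Finset.range n, x k, x n) by fun_prop)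
      measurable_id

/-- The new summand `X n` is independent of the partial sum with the delay already included, so
expectations factor in each term of the binomial expansion. Integrability of all powers propagates
by induction in the same way. -/
lemma integral_pow_sum_range_succ_add [IsProbabilityMeasure μ] (hX : ∀ n, Measurable (X n)) (hU : Measurable U)
    (hindX : iIndepFun X μ) (hindU : IndepFun (fun ω n => X n ω) U μ)
    (hXint : ∀ n k, Integrable (fun ω => X n ω ^ k) μ)
    (hUint : ∀ k, Integrable (fun ω => U ω ^ k) μ) (n : ℕ) :
    (∀ m, Integrable (fun ω => ((∑ k ∈ Finset.range n, X k ω) + U ω) ^ m) μ) ∧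
    ∀ m, ∫ ω, ((∑ k ∈ Finset.range (n + 1), X k ω) + U ω) ^ m ∂μ =
      ∑ j ∈ Finset.range (m + 1), (m.choose j : ℝ) *
        ((∫ ω, ((∑ k ∈ Finset.range n, X k ω) + U ω) ^ j ∂μ) * ∫ ω, X n ω ^ (m - j) ∂μ) := by
  have hexp : ∀ n m ω, ((∑ k ∈ Finset.range (n + 1), X k ω) + U ω) ^ m =
      ∑ j ∈ Finset.range (m + 1), (m.choose j : ℝ) *
        (((∑ k ∈ Finset.range n, X k ω) + U ω) ^ j * X n ω ^ (m - j)) := by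
    intro n m ω
    rw [Finset.sum_range_succ, add_right_comm, add_pow]
    exact Finset.sum_congr rfl fun j _ => by ring
  have hind : ∀ n j k, IndepFun (fun ω => ((∑ k ∈ Finset.range n, X k ω) + U ω) ^ j)
      (fun ω => X n ω ^ k) μ := fun n j k =>
    (indepFun_sum_range_add hX hU hindX hindU n).comp (measurable_id.pow_const j)
      (measurable_id.pow_const k)
  have hint : ∀ n m, Integrable (fun ω => ((∑ k ∈ Finset.range n, X k ω) + U ω) ^ m) μ := by
    intro n
    induction n with
    | zero => simpa using hUint
    | succ n ih =>
      intro m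
      simp_rw [hexp]
      exact integrable_finsetSum _ fun j _ =>
        ((hind n j (m - j)).integrable_mul (ih j) (hXint n _)).const_mul _
  refine ⟨hint n, fun m => ?_⟩
  simp_rw [hexp]
  rw [integral_finsetSum]
  swap
  · exact fun j _ => ((hind n j (m - j)).integrable_mul (hint n j) (hXint n _)).const_mul _
  refine Finset.sum_congr rfl fun j _ => ?_
  rw [integral_const_mul, (hind n j (m - j)).integral_fun_mul_eq_mul_integral
    (hint n j).aestronglyMeasurable (hXint n _).aestronglyMeasurable]

/-- The mean of a random element of a sequence of functions of `Z`, the random index being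
independent of `Z`. -/
lemma hasSum_integral_comp_of_indepFun {E : Type*} [MeasurableSpace E] {R : Ω → ℕ}
    (hR : Measurable R) {Z : Ω → E} (hind : IndepFun R Z μ) {g : ℕ → E → ℝ}
    (hg : ∀ n, Measurable (g n)) (hint : ∀ n, Integrable (fun ω => g n (Z ω)) μ)
    (hnonneg : ∀ n, ∀ᵐ ω ∂μ, 0 ≤ g n (Z ω))
    (hsum : Summable fun n => μ.real {ω | R ω = n} * ∫ ω, g n (Z ω) ∂μ) :
    Integrable (fun ω => g (R ω) (Z ω)) μ ∧
      HasSum (fun n => μ.real {ω | R ω = n} * ∫ ω, g n (Z ω) ∂μ)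
        (∫ ω, g (R ω) (Z ω) ∂μ) := by
  have hms : ∀ n, MeasurableSet {ω | R ω = n} := fun n => hR (measurableSet_singleton n)
  have hU : ⋃ n, {ω | R ω = n} = Set.univ := by ext; simp
  have hdisj : Pairwise (Function.onFun Disjoint fun n => {ω | R ω = n}) := by
    intro i j hij
    refine Set.disjoint_left.2 fun ω hi hj => hij ?_
    exact hi.symm.trans hj
  have heq : ∀ n, Set.EqOn (fun ω => g n (Z ω)) (fun ω => g (R ω) (Z ω)) {ω | R ω = n} := by
    intro n ω hω
    simp [show R ω = n from hω]
  have hval : ∀ n, ∫ ω in {ω | R ω = n}, g n (Z ω) ∂μ =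
      μ.real {ω | R ω = n} * ∫ ω, g n (Z ω) ∂μ := by
    intro n
    -- The event `{R = n}` enters through its indicator, a function of `R`, and so factors out of
    -- the integral.
    have h1 : IndepFun (fun ω => ({n} : Set ℕ).indicator (fun _ => (1 : ℝ)) (R ω))
        (fun ω => g n (Z ω)) μ :=
      hind.comp (measurable_of_countable (({n} : Set ℕ).indicator fun _ => (1 : ℝ))) (hg n)
    have h2 := h1.integral_fun_mul_eq_mul_integral
      ((measurable_of_countable (({n} : Set ℕ).indicator fun _ => (1 : ℝ))).comp
        hR).aestronglyMeasurable (hint n).aestronglyMeasurable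
    have h3 : ∀ ω, ({n} : Set ℕ).indicator (fun _ => (1 : ℝ)) (R ω) =
        ({ω | R ω = n}).indicator (fun _ => (1 : ℝ)) ω := fun ω => rfl
    simp_rw [h3] at h2
    rw [integral_indicator_const _ (hms n), smul_eq_mul, mul_one] at h2
    rw [← h2, ← integral_indicator (hms n)]
    refine integral_congr_ae (ae_of_all _ fun ω => ?_)
    by_cases h : R ω = n <;> simp [h]
  have hio : ∀ n, IntegrableOn (fun ω => g (R ω) (Z ω)) {ω | R ω = n} μ := fun n =>
    (hint n).integrableOn.congr_fun (heq n) (hms n)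
  have hset : ∀ n, ∫ ω in {ω | R ω = n}, g (R ω) (Z ω) ∂μ =
      μ.real {ω | R ω = n} * ∫ ω, g n (Z ω) ∂μ := fun n => by
    rw [← hval, setIntegral_congr_fun (hms n) (heq n)]
  have hnn : ∀ᵐ ω ∂μ, ∀ n, 0 ≤ g n (Z ω) := ae_all_iff.2 hnonneg
  have hnorm : ∀ n, ∫ ω in {ω | R ω = n}, ‖g (R ω) (Z ω)‖ ∂μ =
      μ.real {ω | R ω = n} * ∫ ω, g n (Z ω) ∂μ := fun n => by
    rw [← hset]
    refine integral_congr_ae (ae_restrict_of_ae ?_)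
    filter_upwards [hnn] with ω hω
    exact Real.norm_of_nonneg (hω _)
  -- By nonnegativity the integrals of the norm over the pieces `{R = n}` are the terms of the given
  -- summable series.
  have hall : IntegrableOn (fun ω => g (R ω) (Z ω)) (⋃ n, {ω | R ω = n}) μ :=
    integrableOn_iUnion_of_summable_integral_norm hio (by simp_rw [hnorm]; exact hsum)
  have hh := hasSum_integral_iUnion hms hdisj hall
  rw [hU] at hall hh
  simp_rw [hset] at hh
  rw [setIntegral_univ] at hh
  exact ⟨integrableOn_univ.1 hall, hh⟩

/-- Moments of a geometric sum of independent variables with common moments, plus an independent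
delay. -/
lemma moments_geometric_sum [IsProbabilityMeasure μ] {p : ℝ} (hp0 : 0 < p) (hp1 : p ≤ 1) {R : Ω → ℕ} {T : Ω → ℝ}
    {s : ℕ → ℝ} (hR : Measurable R) (hX : ∀ n, Measurable (X n)) (hU : Measurable U)
    (hRlaw : ∀ n : ℕ, μ.real {ω | R ω = n} = (1 - p) ^ n * p)
    (hindX : iIndepFun X μ) (hindU : IndepFun (fun ω n => X n ω) U μ)
    (hindR : IndepFun R (fun ω => ((fun n => X n ω), U ω)) μ)
    (hX0 : ∀ n, ∀ᵐ ω ∂μ, 0 ≤ X n ω) (hU0 : ∀ᵐ ω ∂μ, 0 ≤ U ω)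
    (hXint : ∀ n k, Integrable (fun ω => X n ω ^ k) μ)
    (hXs : ∀ n k, ∫ ω, X n ω ^ k ∂μ = s k)
    (hUint : ∀ k, Integrable (fun ω => U ω ^ k) μ)
    (hT : ∀ᵐ ω ∂μ, T ω = (∑ n ∈ Finset.range (R ω), X n ω) + U ω) (m : ℕ) :
    Integrable (fun ω => T ω ^ m) μ ∧
      p * ∫ ω, T ω ^ m ∂μ = p * ∫ ω, U ω ^ m ∂μ +
        (1 - p) * ∑ j ∈ Finset.range m, (m.choose j : ℝ) * s (m - j) * ∫ ω, T ω ^ j ∂μ := by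
  set f : ℕ → ℕ → ℝ := fun m n => ∫ ω, ((∑ k ∈ Finset.range n, X k ω) + U ω) ^ m ∂μ with hf
  have hV := integral_pow_sum_range_succ_add hX hU hindX hindU hXint hUint
  have hall0 : ∀ᵐ ω ∂μ, ∀ n, 0 ≤ X n ω := ae_all_iff.2 hX0
  have hnn : ∀ m n, ∀ᵐ ω ∂μ, 0 ≤ ((∑ k ∈ Finset.range n, X k ω) + U ω) ^ m := by
    intro m n
    filter_upwards [hall0, hU0] with ω h1 h2
    exact pow_nonneg (add_nonneg (Finset.sum_nonneg fun k _ => h1 k) h2) m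
  have hgen := summable_geometric_mul_of_binomial_recursion (q := 1 - p) (by linarith)
    (by linarith) (f := f) (s := s) (fun m n => integral_nonneg_of_ae (hnn m n))
    (fun k => by
      rw [← hXs 0 k]
      refine integral_nonneg_of_ae ?_
      filter_upwards [hX0 0] with ω h using pow_nonneg h k)
    (by rw [← hXs 0 0]; simp) (fun m n => by simp only [hf, (hV n).2, hXs])
  have hmain : ∀ m, Integrable (fun ω => T ω ^ m) μ ∧
      ∫ ω, T ω ^ m ∂μ = p * ∑' n, (1 - p) ^ n * f m n := by
    intro m
    have hterm : ∀ n : ℕ, μ.real {ω | R ω = n} * f m n = p * ((1 - p) ^ n * f m n) := fun n => by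
      rw [hRlaw]; ring
    have key := hasSum_integral_comp_of_indepFun hR hindR
      (g := fun n z => ((∑ k ∈ Finset.range n, z.1 k) + z.2) ^ m) (fun n => by fun_prop)
      (fun n => (hV n).1 m) (hnn m) (by
        change Summable fun n : ℕ => μ.real {ω | R ω = n} * f m n
        simp_rw [hterm]
        exact (hgen m).1.mul_left p)
    have hTm : (fun ω => T ω ^ m) =ᵐ[μ]
        fun ω => ((∑ k ∈ Finset.range (R ω), X k ω) + U ω) ^ m := by
      filter_upwards [hT] with ω hω
      rw [hω]
    refine ⟨key.1.congr hTm.symm, ?_⟩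
    rw [integral_congr_ae hTm, ← key.2.tsum_eq, ← tsum_mul_left]
    exact tsum_congr hterm
  refine ⟨(hmain m).1, ?_⟩
  have h2 := (hgen m).2
  rw [sub_sub_cancel] at h2
  simp_rw [(hmain _).2]
  rw [h2, mul_add]
  congr 1
  · simp [hf]
  · rw [mul_left_comm, Finset.mul_sum]
    congr 1
    exact Finset.sum_congr rfl fun j _ => by ring

end RandomSum

/-! ### The unit exponential law -/

lemma expMeasure_one_eq_withDensity :
    expMeasure 1 = (volume.restrict (Set.Ioi (0 : ℝ))).withDensity
      fun y => ENNReal.ofReal (Real.exp (-y)) := by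
  rw [expMeasure, gammaMeasure, ← Measure.restrict_congr_set Ioi_ae_eq_Ici.symm,
    ← withDensity_indicator measurableSet_Ici]
  congr 1
  ext y
  by_cases hy : 0 ≤ y
  · simp [gammaPDF_of_nonneg hy, hy]
  · simp [gammaPDF_of_neg (not_le.1 hy), hy]

lemma ae_pos_expMeasure : ∀ᵐ y ∂expMeasure 1, (0 : ℝ) < y := by
  rw [expMeasure_one_eq_withDensity]
  exact (withDensity_absolutelyContinuous _ _).ae_le (ae_restrict_mem measurableSet_Ioi)

instance noAtoms_expMeasure_one : NullSingletonClass (expMeasure 1) := by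
  rw [expMeasure, gammaMeasure]
  infer_instance

lemma integrable_rpow_expMeasure {s : ℝ} (hs : 0 ≤ s) :
    Integrable (fun y : ℝ => y ^ s) (expMeasure 1) := by
  rw [expMeasure_one_eq_withDensity, integrable_withDensity_iff_integrable_smul' (by fun_prop)
    (by simp)]
  have := Real.GammaIntegral_convergent (s := s + 1) (by linarith)
  refine this.congr (ae_of_all _ fun y => ?_)
  simp [Real.exp_nonneg]

lemma integral_rpow_expMeasure {s : ℝ} (hs : 0 ≤ s) :
    ∫ y : ℝ, y ^ s ∂expMeasure 1 = Real.Gamma (s + 1) := by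
  rw [expMeasure_one_eq_withDensity, integral_withDensity_eq_integral_toReal_smul (by fun_prop)
    (by simp), Real.Gamma_eq_integral (by linarith)]
  refine integral_congr_ae (ae_of_all _ fun y => ?_)
  simp [Real.exp_nonneg]

lemma integrable_pow_expMeasure (k : ℕ) : Integrable (fun y : ℝ => y ^ k) (expMeasure 1) := by
  simpa using integrable_rpow_expMeasure (s := k) (by positivity)

lemma integral_pow_expMeasure (k : ℕ) : ∫ y : ℝ, y ^ k ∂expMeasure 1 = k ! := by
  simpa [Real.Gamma_nat_eq_factorial] using integral_rpow_expMeasure (s := k) (by positivity)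

/-! ### Behaviour of the distribution function near zero -/

section DistFun

variable {Ω : Type*} [MeasurableSpace Ω] {P : Measure Ω} {τ : Ω → EReal}

lemma distFun_nonneg (t : ℝ) : 0 ≤ distFun P τ t := measureReal_nonneg

lemma distFun_le_one [IsProbabilityMeasure P] (t : ℝ) : distFun P τ t ≤ 1 := measureReal_le_one

lemma monotone_distFun [IsProbabilityMeasure P] : Monotone (distFun P τ) := fun s t hst =>
  measureReal_mono fun _ hω => le_trans (show τ _ ≤ (s : EReal) from hω) (by exact_mod_cast hst)

lemma tendsto_distFun_div_rpow {A b : ℝ} (hA : 0 < A)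
    (hF : distFun P τ ~[𝓝[>] (0 : ℝ)] fun t : ℝ => A * t ^ b) :
    Tendsto (fun t => distFun P τ t / t ^ b) (𝓝[>] 0) (𝓝 A) := by
  have hne : ∀ᶠ t : ℝ in 𝓝[>] 0, A * t ^ b ≠ 0 := by
    filter_upwards [self_mem_nhdsWithin] with t ht
    exact (mul_pos hA (Real.rpow_pos_of_pos ht b)).ne'
  have h := ((isEquivalent_iff_tendsto_one hne).1 hF).mul_const A
  rw [one_mul] at h
  refine h.congr fun t => ?_
  simp only [Pi.div_apply]
  field_simp

lemma exists_distFun_le_rpow [IsProbabilityMeasure P] {A b : ℝ} (hA : 0 < A) (hb : 0 < b)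
    (hF : distFun P τ ~[𝓝[>] (0 : ℝ)] fun t : ℝ => A * t ^ b) :
    ∃ C, 0 < C ∧ ∀ t, 0 < t → distFun P τ t ≤ C * t ^ b := by
  have h1 : ∀ᶠ t : ℝ in 𝓝[>] 0, distFun P τ t / t ^ b < A + 1 :=
    (tendsto_distFun_div_rpow hA hF).eventually_lt_const (by linarith)
  obtain ⟨δ, hδ, hδ'⟩ := mem_nhdsGT_iff_exists_Ioo_subset.1 h1
  have hδ0 : (0 : ℝ) < δ := hδ
  have hδb := Real.rpow_pos_of_pos hδ0 b
  -- Below `δ` the ratio `F_τ(t) / t^b` is less than `A + 1`; from `δ` on, `F_τ ≤ 1 ≤ (t/δ)^b`.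
  refine ⟨(A + 1) + (δ ^ b)⁻¹, by positivity, fun t ht => ?_⟩
  have htb := Real.rpow_pos_of_pos ht b
  rw [add_mul]
  rcases lt_or_ge t δ with h | h
  · have := hδ' ⟨ht, h⟩
    rw [Set.mem_ofPred_eq, div_lt_iff₀ htb] at this
    have : 0 ≤ (δ ^ b)⁻¹ * t ^ b := by positivity
    linarith
  · have h3 : δ ^ b ≤ t ^ b := Real.rpow_le_rpow hδ0.le h hb.le
    have h4 : 1 ≤ (δ ^ b)⁻¹ * t ^ b := by
      rw [inv_mul_eq_div, le_div_iff₀ hδb]; linarith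
    have : 0 ≤ (A + 1) * t ^ b := by positivity
    linarith [distFun_le_one (P := P) (τ := τ) t]

/-- Dominated convergence: the scaled integrand tends pointwise to `A y^b`, and the global power
bound supplies the majorant `C y^b`. -/
lemma tendsto_rpow_mul_integral_distFun [IsProbabilityMeasure P] {A b : ℝ} (hA : 0 < A) (hb : 0 < b)
    (hF : distFun P τ ~[𝓝[>] (0 : ℝ)] fun t : ℝ => A * t ^ b) :
    Tendsto (fun r : ℝ => r ^ b * ∫ y, distFun P τ (y / r) ∂expMeasure 1) atTop
      (𝓝 (Real.Gamma (b + 1) * A)) := by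
  obtain ⟨C, hC, hFC⟩ := exists_distFun_le_rpow hA hb hF
  have hlim : Tendsto (fun r : ℝ => ∫ y, r ^ b * distFun P τ (y / r) ∂expMeasure 1) atTop
      (𝓝 (∫ y : ℝ, y ^ b * A ∂expMeasure 1)) := by
    refine tendsto_integral_filter_of_dominated_convergence (fun y => C * y ^ b)
      (Eventually.of_forall fun r => ?_) ?_ ((integrable_rpow_expMeasure hb.le).const_mul C) ?_
    · have := (monotone_distFun (P := P) (τ := τ)).measurable
      exact (by fun_prop : Measurable fun y => r ^ b * distFun P τ (y / r)).aestronglyMeasurable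
    · filter_upwards [eventually_gt_atTop 0] with r hr
      filter_upwards [ae_pos_expMeasure] with y hy
      have := Real.rpow_pos_of_pos hr b
      rw [Real.norm_of_nonneg (mul_nonneg this.le (distFun_nonneg _))]
      calc r ^ b * distFun P τ (y / r) ≤ r ^ b * (C * (y / r) ^ b) :=
            mul_le_mul_of_nonneg_left (hFC _ (div_pos hy hr)) this.le
        _ = C * y ^ b := by rw [Real.div_rpow hy.le hr.le]; field_simp
    · filter_upwards [ae_pos_expMeasure] with y hy
      have h0 : Tendsto (fun r : ℝ => y / r) atTop (𝓝[>] 0) := by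
        refine tendsto_nhdsWithin_iff.2 ⟨tendsto_const_nhds.div_atTop tendsto_id, ?_⟩
        filter_upwards [eventually_gt_atTop 0] with r hr using div_pos hy hr
      refine (((tendsto_distFun_div_rpow hA hF).comp h0).const_mul (y ^ b)).congr' ?_
      filter_upwards [eventually_gt_atTop 0] with r hr
      have := Real.rpow_pos_of_pos hr b
      have := Real.rpow_pos_of_pos hy b
      simp only [Function.comp, Real.div_rpow hy.le hr.le]
      field_simp
  rw [integral_mul_const, integral_rpow_expMeasure hb.le] at hlim
  simpa only [integral_const_mul] using hlim

end DistFun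

/-! ### Success and reset events for exponential resetting -/

section ExponentialReset

variable {Ω : Type*} [MeasurableSpace Ω] {P : Measure Ω} {τ : Ω → EReal}
  {Y : Ω → ℝ}

lemma measurable_resetTime (hY : Measurable Y) (r : ℝ) : Measurable (resetTime Y r) :=
  hY.div_const r

lemma measurableSet_successEvent (hτ : Measurable τ) {σ : Ω → ℝ} (hσ : Measurable σ) :
    MeasurableSet (successEvent τ σ) := measurableSet_lt hτ hσ.coe_real_ereal

lemma measurableSet_resetEvent (hτ : Measurable τ) {σ : Ω → ℝ} (hσ : Measurable σ) :
    MeasurableSet (resetEvent τ σ) := measurableSet_lt hσ.coe_real_ereal hτ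

lemma integrable_pow_of_hasLaw_exp (hY_exp : HasLaw Y (expMeasure 1) P) (k : ℕ) :
    Integrable (fun ω => Y ω ^ k) P := by
  have := integrable_pow_expMeasure k
  rw [← hY_exp.map_eq] at this
  exact this.comp_aemeasurable hY_exp.aemeasurable

lemma integral_pow_of_hasLaw_exp (hY_exp : HasLaw Y (expMeasure 1) P) (k : ℕ) :
    ∫ ω, Y ω ^ k ∂P = k ! := by
  rw [← integral_pow_expMeasure, ← hY_exp.map_eq,
    integral_map hY_exp.aemeasurable (by fun_prop)]

lemma ae_pos_of_hasLaw_exp (hY_exp : HasLaw Y (expMeasure 1) P) : ∀ᵐ ω ∂P, 0 < Y ω := by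
  have := ae_pos_expMeasure
  rw [← hY_exp.map_eq] at this
  exact ae_of_ae_map hY_exp.aemeasurable this

/-- Given `Y = y`, no reset before `τ` means `τ ≤ y / r`, of probability `F_τ(y/r)`; independence
and Fubini do the rest. The case `k = 0` computes `p`, and general `k` measures the effect of
conditioning on the moments of `Y`. -/
lemma setIntegral_pow_compl_resetEvent [IsProbabilityMeasure P] (hτ : Measurable τ) (hY : Measurable Y)
    (hY_exp : HasLaw Y (expMeasure 1) P) (hτY : IndepFun τ Y P) (r : ℝ) (k : ℕ) :
    ∫ ω in (resetEvent τ (resetTime Y r))ᶜ, Y ω ^ k ∂P =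
      ∫ y, y ^ k * distFun P τ (y / r) ∂expMeasure 1 := by
  set S : Set (EReal × ℝ) := {z | z.1 ≤ ((z.2 / r : ℝ) : EReal)} with hS
  have hSm : MeasurableSet S :=
    measurableSet_le measurable_fst (measurable_snd.div_const r).coe_real_ereal
  have hmap := (indepFun_iff_map_prod_eq_prod_map_map hτ.aemeasurable hY.aemeasurable).1 hτY
  have := Measure.isProbabilityMeasure_map (μ := P) hτ.aemeasurable
  have := Measure.isProbabilityMeasure_map (μ := P) hY.aemeasurable
  set g : EReal × ℝ → ℝ := S.indicator fun z => z.2 ^ k with hg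
  have hgm : Measurable g := (measurable_snd.pow_const k).indicator hSm
  have hgint : Integrable (fun ω => g (τ ω, Y ω)) P :=
    ((integrable_pow_of_hasLaw_exp hY_exp k).indicator ((hτ.prodMk hY) hSm)).congr
      (ae_of_all _ fun ω => by simp only [hg, Set.indicator, Set.mem_preimage])
  have hgint' : Integrable g ((P.map τ).prod (P.map Y)) := by
    rw [← hmap, integrable_map_measure hgm.aestronglyMeasurable (hτ.prodMk hY).aemeasurable]
    exact hgint
  rw [← integral_indicator (measurableSet_resetEvent hτ (measurable_resetTime hY r)).compl]
  trans ∫ ω, g (τ ω, Y ω) ∂P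
  · refine integral_congr_ae (ae_of_all _ fun ω => ?_)
    simp [hg, hS, Set.indicator, resetEvent, resetTime]
  rw [← integral_map (hτ.prodMk hY).aemeasurable hgm.aestronglyMeasurable, hmap, integral_prod_symm _ hgint', hY_exp.map_eq]
  refine integral_congr_ae (ae_of_all _ fun y => ?_)
  have hs : MeasurableSet {x : EReal | x ≤ ((y / r : ℝ) : EReal)} := measurableSet_Iic
  have : ∀ x, g (x, y) = {x : EReal | x ≤ ((y / r : ℝ) : EReal)}.indicator (fun _ => y ^ k) x := by
    intro x
    simp [hg, hS, Set.indicator]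
  simp_rw [this]
  rw [integral_indicator_const _ hs, smul_eq_mul, mul_comm, map_measureReal_apply hτ hs]
  rfl

lemma setIntegral_pow_compl_resetEvent_le [IsProbabilityMeasure P] {A b : ℝ} (hA : 0 < A) (hb : 0 < b)
    (hτ : Measurable τ) (hY : Measurable Y)
    (hY_exp : HasLaw Y (expMeasure 1) P) (hτY : IndepFun τ Y P)
    (hF : distFun P τ ~[𝓝[>] (0 : ℝ)] fun t : ℝ => A * t ^ b) (k : ℕ) :
    ∃ C, ∀ r, 0 < r →
      ∫ ω in (resetEvent τ (resetTime Y r))ᶜ, Y ω ^ k ∂P ≤ C * r ^ (-b) := by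
  obtain ⟨C, hC, hFC⟩ := exists_distFun_le_rpow hA hb hF
  have hint : Integrable (fun y : ℝ => y ^ ((k : ℝ) + b)) (expMeasure 1) :=
    integrable_rpow_expMeasure (by positivity)
  refine ⟨C * ∫ y : ℝ, y ^ ((k : ℝ) + b) ∂expMeasure 1, fun r hr => ?_⟩
  rw [setIntegral_pow_compl_resetEvent hτ hY hY_exp hτY, mul_right_comm, ← integral_const_mul]
  refine integral_mono_of_nonneg ?_ (hint.const_mul _) ?_
  · filter_upwards [ae_pos_expMeasure] with y hy
    exact mul_nonneg (pow_nonneg hy.le k) (distFun_nonneg _)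
  · filter_upwards [ae_pos_expMeasure] with y hy
    calc y ^ k * distFun P τ (y / r) ≤ y ^ k * (C * (y / r) ^ b) :=
          mul_le_mul_of_nonneg_left (hFC _ (div_pos hy hr)) (pow_nonneg hy.le k)
      _ = C * r ^ (-b) * y ^ ((k : ℝ) + b) := by
          rw [Real.div_rpow hy.le hr.le, Real.rpow_add hy, Real.rpow_natCast, Real.rpow_neg hr.le]
          ring

lemma tendsto_setIntegral_pow_compl_resetEvent [IsProbabilityMeasure P] {A b : ℝ} (hA : 0 < A) (hb : 0 < b)
    (hτ : Measurable τ) (hY : Measurable Y)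
    (hY_exp : HasLaw Y (expMeasure 1) P) (hτY : IndepFun τ Y P)
    (hF : distFun P τ ~[𝓝[>] (0 : ℝ)] fun t : ℝ => A * t ^ b) (k : ℕ) :
    Tendsto (fun r => ∫ ω in (resetEvent τ (resetTime Y r))ᶜ, Y ω ^ k ∂P) atTop (𝓝 0) := by
  obtain ⟨C, hC⟩ := setIntegral_pow_compl_resetEvent_le hA hb hτ hY hY_exp hτY hF k
  have h0 : Tendsto (fun r : ℝ => C * r ^ (-b)) atTop (𝓝 0) := by
    simpa using (tendsto_rpow_neg_atTop hb).const_mul C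
  refine squeeze_zero' (Eventually.of_forall fun r => ?_) ?_ h0
  · refine integral_nonneg_of_ae (ae_restrict_of_ae ?_)
    filter_upwards [ae_pos_of_hasLaw_exp hY_exp] with ω hω using pow_nonneg hω.le k
  · filter_upwards [eventually_gt_atTop 0] with r hr using hC r hr

/-- The two events differ by the tie `τ = Y / r`. For each fixed value of `τ` at most one value of
`Y` gives a tie, and the exponential law has no atoms. -/
lemma successEvent_ae_eq_compl_resetEvent [IsProbabilityMeasure P] (hτ : Measurable τ) (hY : Measurable Y)
    (hY_exp : HasLaw Y (expMeasure 1) P) (hτY : IndepFun τ Y P) {r : ℝ} (hr : 0 < r) :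
    successEvent τ (resetTime Y r) =ᵐ[P]
      ((resetEvent τ (resetTime Y r))ᶜ : Set Ω) := by
  set S : Set (EReal × ℝ) := {z | z.1 = ((z.2 / r : ℝ) : EReal)} with hS
  have hSm : MeasurableSet S :=
    measurableSet_eq_fun measurable_fst (measurable_snd.div_const r).coe_real_ereal
  have hmap := (indepFun_iff_map_prod_eq_prod_map_map hτ.aemeasurable hY.aemeasurable).1 hτY
  have := Measure.isProbabilityMeasure_map (μ := P) hY.aemeasurable
  have h0 : P {ω | τ ω = ((Y ω / r : ℝ) : EReal)} = 0 := by
    change P ((fun ω => (τ ω, Y ω)) ⁻¹' S) = 0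
    rw [← Measure.map_apply (hτ.prodMk hY) hSm, hmap, Measure.measure_prod_null hSm]
    refine ae_of_all _ fun x => ?_
    rw [hY_exp.map_eq]
    refine Set.Subsingleton.measure_zero (fun y hy z hz => ?_) _
    have h : ((y / r : ℝ) : EReal) = ((z / r : ℝ) : EReal) :=
      (show x = _ from hy).symm.trans (show x = _ from hz)
    rw [EReal.coe_eq_coe_iff] at h
    field_simp at h
    exact h
  have h1 : ∀ᵐ ω ∂P, τ ω ≠ ((Y ω / r : ℝ) : EReal) := by
    rw [ae_iff]; simpa using h0
  refine eventuallyEq_set.2 ?_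
  filter_upwards [h1] with ω hω
  simp only [successEvent, resetEvent, resetTime, Set.mem_compl_iff, Set.mem_ofPred_eq, not_lt]
  exact ⟨le_of_lt, fun h => lt_of_le_of_ne h hω⟩

lemma successProb_eq_one_sub [IsProbabilityMeasure P] (hτ : Measurable τ) (hY : Measurable Y)
    (hY_exp : HasLaw Y (expMeasure 1) P) (hτY : IndepFun τ Y P) {r : ℝ} (hr : 0 < r) :
    successProb P τ (resetTime Y r) = 1 - P.real (resetEvent τ (resetTime Y r)) := by
  rw [successProb, measureReal_congr (successEvent_ae_eq_compl_resetEvent hτ hY hY_exp hτY hr),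
    probReal_compl_eq_one_sub (measurableSet_resetEvent hτ (measurable_resetTime hY r))]

lemma tendsto_rpow_mul_successProb [IsProbabilityMeasure P] {A b : ℝ} (hA : 0 < A) (hb : 0 < b)
    (hτ : Measurable τ) (hY : Measurable Y)
    (hY_exp : HasLaw Y (expMeasure 1) P) (hτY : IndepFun τ Y P)
    (hF : distFun P τ ~[𝓝[>] (0 : ℝ)] fun t : ℝ => A * t ^ b) :
    Tendsto (fun r : ℝ => r ^ b * successProb P τ (resetTime Y r)) atTop
      (𝓝 (Real.Gamma (b + 1) * A)) := by
  refine (tendsto_rpow_mul_integral_distFun hA hb hF).congr' ?_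
  filter_upwards [eventually_gt_atTop 0] with r hr
  have := setIntegral_pow_compl_resetEvent hτ hY hY_exp hτY r 0
  simp only [pow_zero, one_mul, integral_const, smul_eq_mul, mul_one, measureReal_restrict_apply,
    MeasurableSet.univ, Set.univ_inter] at this
  rw [← this, successProb,
    measureReal_congr (successEvent_ae_eq_compl_resetEvent hτ hY hY_exp hτY hr)]

end ExponentialReset

/-! ### Conditional laws and the renewal recursion -/

/-- Two real random variables with the same survival function have the same law. -/
lemma map_eq_of_survival_eq {Ω Ω' : Type*} [MeasurableSpace Ω] [MeasurableSpace Ω']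
    {μ : Measure Ω} {ν : Measure Ω'} [IsProbabilityMeasure μ] [IsProbabilityMeasure ν]
    {f : Ω → ℝ} {g : Ω' → ℝ} (hf : Measurable f) (hg : Measurable g)
    (h : ∀ t : ℝ, μ.real {ω | t < f ω} = ν.real {ω | t < g ω}) : μ.map f = ν.map g := by
  have := Measure.isProbabilityMeasure_map (μ := μ) hf.aemeasurable
  have := Measure.isProbabilityMeasure_map (μ := ν) hg.aemeasurable
  refine Measure.ext_of_Iic _ _ fun t => ?_
  rw [← measureReal_eq_measureReal_iff, ← Set.compl_Ioi, probReal_compl_eq_one_sub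
    measurableSet_Ioi, probReal_compl_eq_one_sub measurableSet_Ioi,
    map_measureReal_apply hf measurableSet_Ioi, map_measureReal_apply hg measurableSet_Ioi]
  exact congrArg _ (h t)

lemma integral_cond_eq {Ω : Type*} [MeasurableSpace Ω] (μ : Measure Ω) (s : Set Ω) (f : Ω → ℝ) :
    ∫ ω, f ω ∂μ[|s] = (μ.real s)⁻¹ * ∫ ω in s, f ω ∂μ := by
  rw [ProbabilityTheory.cond, integral_smul_measure, ENNReal.toReal_inv, smul_eq_mul]; rfl

lemma integrable_cond_of_integrableOn {Ω : Type*} [MeasurableSpace Ω] {μ : Measure Ω} {s : Set Ω}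
    (hs : μ s ≠ 0) {f : Ω → ℝ} (hf : IntegrableOn f s μ) : Integrable f μ[|s] :=
  hf.smul_measure (by simpa using hs)

section Conditional

variable {Ω : Type*} [MeasurableSpace Ω] {P : Measure Ω}
  {τ : Ω → EReal} {σ : Ω → ℝ}

lemma ae_pos_of_distFun_zero [IsProbabilityMeasure P] (h : distFun P τ 0 = 0) : ∀ᵐ ω ∂P, 0 < τ ω := by
  rw [ae_iff]
  rw [distFun, measureReal_eq_zero_iff] at h
  simpa using h

/-- On success `τ` is squeezed between `0` and the finite `σ`, so the default value `0` of
`EReal.toReal` at infinity never interferes and `τ⁻` inherits the moments of `σ`. -/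
lemma ae_toReal_mem_Icc_of_successEvent (hτ : Measurable τ) (hσ : Measurable σ)
    (hτ0 : ∀ᵐ ω ∂P, 0 < τ ω) :
    ∀ᵐ ω ∂P.restrict (successEvent τ σ),
      ((τ ω).toReal : EReal) = τ ω ∧ 0 ≤ (τ ω).toReal ∧ (τ ω).toReal ≤ σ ω := by
  filter_upwards [ae_restrict_of_ae hτ0, ae_restrict_mem (measurableSet_successEvent hτ hσ)]
    with ω h0 h1
  have h2 : τ ω < (σ ω : EReal) := h1
  have h3 : ((τ ω).toReal : EReal) = τ ω :=
    EReal.coe_toReal (h2.trans_le le_top).ne (bot_le.trans_lt h0).ne'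
  refine ⟨h3, EReal.toReal_nonneg h0.le, ?_⟩
  rw [← h3, EReal.coe_lt_coe_iff] at h2
  exact h2.le

lemma integrableOn_toReal_pow (hτ : Measurable τ) (hσ : Measurable σ)
    (hτ0 : ∀ᵐ ω ∂P, 0 < τ ω) {k : ℕ} (hint : Integrable (fun ω => σ ω ^ k) P) :
    IntegrableOn (fun ω => (τ ω).toReal ^ k) (successEvent τ σ) P := by
  refine Integrable.mono (hint.integrableOn (s := successEvent τ σ))
    (hτ.ereal_toReal.pow_const k).aestronglyMeasurable ?_
  filter_upwards [ae_toReal_mem_Icc_of_successEvent hτ hσ hτ0] with ω h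
  rw [Real.norm_of_nonneg (pow_nonneg h.2.1 k),
    Real.norm_of_nonneg (pow_nonneg (h.2.1.trans h.2.2) k)]
  exact pow_le_pow_left₀ h.2.1 h.2.2 k

/-- The moments of a first passage time under resetting satisfy the renewal recursion. -/
lemma IsResetFPT.moments [IsProbabilityMeasure P] {Ω' : Type*} [MeasurableSpace Ω'] {Q : Measure Ω'}
    [IsProbabilityMeasure Q] {T : Ω' → ℝ} (hT : IsResetFPT P τ σ Q T)
    (hτ : Measurable τ) (hσ : Measurable σ) (hτ0 : ∀ᵐ ω ∂P, 0 < τ ω) (hσ0 : ∀ᵐ ω ∂P, 0 ≤ σ ω)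
    (hint : ∀ k, Integrable (fun ω => σ ω ^ k) P)
    (hp : 0 < successProb P τ σ) (hq : 0 < P.real (resetEvent τ σ)) (m : ℕ) :
    Integrable (fun ω => T ω ^ m) Q ∧
      successProb P τ σ * ∫ ω, T ω ^ m ∂Q =
        successProb P τ σ * ∫ ω, (τ ω).toReal ^ m ∂P[|successEvent τ σ] +
        (1 - successProb P τ σ) * ∑ j ∈ Finset.range m, (m.choose j : ℝ) *
          (∫ ω, σ ω ^ (m - j) ∂P[|resetEvent τ σ]) * ∫ ω, T ω ^ j ∂Q := by
  obtain ⟨R, X, U, hR, hX, hU, hRlaw, hXlaw, hUlaw, hindX, hindU, hindR, hTeq⟩ :=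
    hT.exists_decomposition
  have hps : P (successEvent τ σ) ≠ 0 := fun h => hp.ne' (by simp [successProb, measureReal_def, h])
  have hqs : P (resetEvent τ σ) ≠ 0 := fun h => hq.ne' (by simp [measureReal_def, h])
  have := cond_isProbabilityMeasure hps
  have := cond_isProbabilityMeasure hqs
  have hXmap : ∀ n, Q.map (X n) = P[|resetEvent τ σ].map σ := fun n =>
    map_eq_of_survival_eq (hX n) hσ (hXlaw n)
  have hsucc : ∀ᵐ ω ∂P[|successEvent τ σ],
      ((τ ω).toReal : EReal) = τ ω ∧ 0 ≤ (τ ω).toReal ∧ (τ ω).toReal ≤ σ ω :=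
    Measure.smul_absolutelyContinuous.ae_le (ae_toReal_mem_Icc_of_successEvent hτ hσ hτ0)
  -- The survival functions of `τ` and of its real part agree under conditioning on success, where
  -- `τ` is almost surely finite.
  have hUmap : Q.map U = P[|successEvent τ σ].map fun ω => (τ ω).toReal := by
    refine map_eq_of_survival_eq hU hτ.ereal_toReal fun t => (hUlaw t).trans ?_
    refine congrArg ENNReal.toReal (measure_congr (eventuallyEq_set.2 ?_))
    filter_upwards [hsucc] with ω h
    rw [← EReal.coe_lt_coe_iff, h.1]
  have hσ0' : ∀ᵐ ω ∂P[|resetEvent τ σ], 0 ≤ σ ω := cond_absolutelyContinuous.ae_le hσ0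
  have hmom : ∀ k : ℕ, Measurable fun x : ℝ => x ^ k := fun k => measurable_id.pow_const k
  refine moments_geometric_sum hp measureReal_le_one hR hX hU hRlaw hindX hindU hindR
    (fun n => ?_) ?_ (fun n k => ?_) (s := fun k => ∫ ω, σ ω ^ k ∂P[|resetEvent τ σ])
    (fun n k => ?_) (fun k => ?_) hTeq m |>.imp_right fun h => h.trans ?_
  · refine ae_of_ae_map (hX n).aemeasurable (p := fun x => 0 ≤ x) ?_
    rw [hXmap, ae_map_iff hσ.aemeasurable measurableSet_Ici]
    exact hσ0'
  · refine ae_of_ae_map hU.aemeasurable (p := fun x => 0 ≤ x) ?_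
    rw [hUmap, ae_map_iff hτ.ereal_toReal.aemeasurable measurableSet_Ici]
    exact hsucc.mono fun ω h => h.2.1
  · refine (integrable_map_measure (hmom k).aestronglyMeasurable (hX n).aemeasurable).1 ?_
    rw [hXmap, integrable_map_measure (hmom k).aestronglyMeasurable hσ.aemeasurable]
    exact integrable_cond_of_integrableOn hqs (hint k).integrableOn
  · rw [← integral_map (hX n).aemeasurable (hmom k).aestronglyMeasurable, hXmap,
      integral_map hσ.aemeasurable (hmom k).aestronglyMeasurable]
  · refine (integrable_map_measure (hmom k).aestronglyMeasurable hU.aemeasurable).1 ?_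
    rw [hUmap, integrable_map_measure (hmom k).aestronglyMeasurable hτ.ereal_toReal.aemeasurable]
    exact integrable_cond_of_integrableOn hps (integrableOn_toReal_pow hτ hσ hτ0 (hint k))
  · rw [← integral_map hU.aemeasurable (hmom m).aestronglyMeasurable, hUmap,
      integral_map hτ.ereal_toReal.aemeasurable (hmom m).aestronglyMeasurable]

end Conditional

/-! ### Limits as the resetting rate grows -/

section Asymptotics

variable {Ω : Type*} [MeasurableSpace Ω] {P : Measure Ω} [IsProbabilityMeasure P]
  {τ : Ω → EReal} {Y : Ω → ℝ} {A b : ℝ}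

lemma tendsto_successProb (hA : 0 < A) (hb : 0 < b)
    (hτ : Measurable τ) (hY : Measurable Y)
    (hY_exp : HasLaw Y (expMeasure 1) P) (hτY : IndepFun τ Y P)
    (hF : distFun P τ ~[𝓝[>] (0 : ℝ)] fun t : ℝ => A * t ^ b) :
    Tendsto (fun r => successProb P τ (resetTime Y r)) atTop (𝓝 0) := by
  have h := (tendsto_rpow_mul_successProb hA hb hτ hY hY_exp hτY hF).mul
    (tendsto_rpow_neg_atTop hb)
  rw [mul_zero] at h
  refine h.congr' ?_
  filter_upwards [eventually_gt_atTop 0] with r hr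
  have := Real.rpow_pos_of_pos hr b
  rw [Real.rpow_neg hr.le]
  field_simp

lemma eventually_successProb_pos (hA : 0 < A) (hb : 0 < b)
    (hτ : Measurable τ) (hY : Measurable Y)
    (hY_exp : HasLaw Y (expMeasure 1) P) (hτY : IndepFun τ Y P)
    (hF : distFun P τ ~[𝓝[>] (0 : ℝ)] fun t : ℝ => A * t ^ b) :
    ∀ᶠ r in atTop, 0 < successProb P τ (resetTime Y r) := by
  have h := tendsto_rpow_mul_successProb hA hb hτ hY hY_exp hτY hF
  have h1 := h.eventually_const_lt (mul_pos (Real.Gamma_pos_of_pos (by linarith)) hA)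
  filter_upwards [h1, eventually_gt_atTop 0] with r hr hr0
  exact pos_of_mul_pos_right hr (Real.rpow_pos_of_pos hr0 b).le

/-- Since `r σ = Y`, the quantity equals `(k! - ∫ Y^k over no reset) / (1 - p)`, and both the
missing mass and `p` vanish in the limit. -/
lemma tendsto_pow_mul_integral_resetTime (hA : 0 < A) (hb : 0 < b)
    (hτ : Measurable τ) (hY : Measurable Y)
    (hY_exp : HasLaw Y (expMeasure 1) P) (hτY : IndepFun τ Y P)
    (hF : distFun P τ ~[𝓝[>] (0 : ℝ)] fun t : ℝ => A * t ^ b) (k : ℕ) :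
    Tendsto (fun r => r ^ k *
      ∫ ω, resetTime Y r ω ^ k ∂P[|resetEvent τ (resetTime Y r)]) atTop (𝓝 (k ! : ℝ)) := by
  have h1 := tendsto_setIntegral_pow_compl_resetEvent hA hb hτ hY hY_exp hτY hF k
  have h2 := tendsto_successProb hA hb hτ hY hY_exp hτY hF
  have h3 : Tendsto (fun r => (1 - successProb P τ (resetTime Y r))⁻¹ *
      ((k ! : ℝ) - ∫ ω in (resetEvent τ (resetTime Y r))ᶜ, Y ω ^ k ∂P)) atTop
      (𝓝 ((1 - 0)⁻¹ * ((k ! : ℝ) - 0))) :=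
    ((h2.const_sub 1).inv₀ (by simp)).mul (h1.const_sub _)
  rw [sub_zero, sub_zero, inv_one, one_mul] at h3
  refine h3.congr' ?_
  filter_upwards [eventually_gt_atTop 0] with r hr
  have hm := measurableSet_resetEvent hτ (measurable_resetTime hY r)
  rw [successProb_eq_one_sub hτ hY hY_exp hτY hr, sub_sub_cancel, integral_cond_eq,
    ← integral_pow_of_hasLaw_exp hY_exp k,
    ← integral_add_compl hm (integrable_pow_of_hasLaw_exp hY_exp k), add_sub_cancel_right]
  simp_rw [resetTime, div_pow]
  rw [integral_div]
  field_simp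

/-- The factor `p` undoes the normalization of the conditional law. On success `r τ ≤ Y`, so what
remains is at most the integral of `Y^k` over the vanishing event of no reset. -/
lemma tendsto_mul_pow_mul_integral_toReal (hA : 0 < A) (hb : 0 < b)
    (hτ : Measurable τ) (hτ0 : ∀ᵐ ω ∂P, 0 < τ ω) (hY : Measurable Y)
    (hY_exp : HasLaw Y (expMeasure 1) P) (hτY : IndepFun τ Y P)
    (hF : distFun P τ ~[𝓝[>] (0 : ℝ)] fun t : ℝ => A * t ^ b) (k : ℕ) :
    Tendsto (fun r => successProb P τ (resetTime Y r) * (r ^ k *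
      ∫ ω, (τ ω).toReal ^ k ∂P[|successEvent τ (resetTime Y r)])) atTop (𝓝 0) := by
  have h1 := tendsto_setIntegral_pow_compl_resetEvent hA hb hτ hY hY_exp hτY hF k
  have heq : ∀ᶠ r in atTop, successProb P τ (resetTime Y r) * (r ^ k *
      ∫ ω, (τ ω).toReal ^ k ∂P[|successEvent τ (resetTime Y r)]) =
      r ^ k * ∫ ω in successEvent τ (resetTime Y r), (τ ω).toReal ^ k ∂P := by
    filter_upwards [eventually_successProb_pos hA hb hτ hY hY_exp hτY hF] with r hr
    rw [integral_cond_eq, ← successProb]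
    field_simp
  refine squeeze_zero' ?_ ?_ h1
  · filter_upwards [heq, eventually_gt_atTop 0] with r hr hr0
    rw [hr]
    refine mul_nonneg (pow_nonneg hr0.le k) (integral_nonneg_of_ae ?_)
    filter_upwards [ae_toReal_mem_Icc_of_successEvent hτ (measurable_resetTime hY r) hτ0]
      with ω h using pow_nonneg h.2.1 k
  · filter_upwards [heq, eventually_gt_atTop 0] with r hr hr0
    have hYint := integrable_pow_of_hasLaw_exp hY_exp k
    have hσint : Integrable (fun ω => resetTime Y r ω ^ k) P := by
      simp_rw [resetTime, div_pow]
      exact hYint.div_const _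
    rw [hr, ← integral_const_mul]
    calc ∫ ω in successEvent τ (resetTime Y r), r ^ k * (τ ω).toReal ^ k ∂P
        ≤ ∫ ω in successEvent τ (resetTime Y r), Y ω ^ k ∂P := by
          refine integral_mono_ae ((integrableOn_toReal_pow hτ (measurable_resetTime hY r) hτ0
            hσint).const_mul _) hYint.integrableOn ?_
          filter_upwards [ae_toReal_mem_Icc_of_successEvent hτ (measurable_resetTime hY r) hτ0]
            with ω h
          simp only [← mul_pow]
          refine pow_le_pow_left₀ (mul_nonneg hr0.le h.2.1) ?_ k
          have := h.2.2
          rwa [resetTime, le_div_iff₀' hr0] at this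
      _ ≤ ∫ ω in (resetEvent τ (resetTime Y r))ᶜ, Y ω ^ k ∂P := by
          refine setIntegral_mono_set hYint.integrableOn (ae_restrict_of_ae ?_) ?_
          · filter_upwards [ae_pos_of_hasLaw_exp hY_exp] with ω hω using pow_nonneg hω.le k
          · refine LE.le.eventuallyLE fun ω hω => ?_
            exact not_lt.2 (show τ ω < _ from hω).le

end Asymptotics

/-- Limits of rescaled moments determined by a perturbed renewal recursion. -/
lemma tendsto_factorial_of_recursion {ι : Type*} {l : Filter ι} {p : ι → ℝ} {S e B : ℕ → ι → ℝ}
    (hp : Tendsto p l (𝓝 0)) (hS : ∀ k, Tendsto (S k) l (𝓝 (k ! : ℝ)))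
    (he : ∀ n, Tendsto (e n) l (𝓝 0)) (hB0 : Tendsto (B 0) l (𝓝 1))
    (hrec : ∀ n, ∀ᶠ r in l, B (n + 1) r = e n r + (1 - p r) *
      ∑ j ∈ Finset.range (n + 1), ((n + 1).choose j : ℝ) * S (n + 1 - j) r * p r ^ (n - j) * B j r)
    (m : ℕ) : Tendsto (B m) l (𝓝 (m ! : ℝ)) := by
  induction m using Nat.strong_induction_on with
  | _ m ih =>
    cases m with
    | zero => simpa using hB0
    | succ n =>
      have hsum : Tendsto (fun r => ∑ j ∈ Finset.range (n + 1),
          ((n + 1).choose j : ℝ) * S (n + 1 - j) r * p r ^ (n - j) * B j r) l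
          (𝓝 (∑ j ∈ Finset.range (n + 1),
            ((n + 1).choose j : ℝ) * ((n + 1 - j)! : ℝ) * 0 ^ (n - j) * (j ! : ℝ))) :=
        tendsto_finsetSum _ fun j hj =>
          (((hS _).const_mul _).mul (hp.pow _)).mul (ih j (Finset.mem_range.1 hj))
      have h := (he n).add ((hp.const_sub 1).mul hsum)
      -- The factor `0 ^ (n - j)` leaves only `j = n`, which contributes `(n + 1) · 1! · n!`.
      have hval : ∑ j ∈ Finset.range (n + 1),
          ((n + 1).choose j : ℝ) * ((n + 1 - j)! : ℝ) * 0 ^ (n - j) * (j ! : ℝ) =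
          ((n + 1)! : ℝ) := by
        rw [Finset.sum_range_succ, Finset.sum_eq_zero]
        · simp [Nat.factorial_succ]
        · intro j hj
          have := Finset.mem_range.1 hj
          rw [zero_pow (by omega)]
          ring
      rw [hval, zero_add, sub_zero, one_mul] at h
      exact h.congr' ((hrec n).mono fun r hr => hr.symm)

/-! ### The main theorem -/

theorem proposition1
    {Ω : Type*} [MeasurableSpace Ω] (P : Measure Ω) [IsProbabilityMeasure P]
    (τ : Ω → EReal) (hτ : Measurable τ)
    (hτ_zero : distFun P τ 0 = 0)
    (hτ_pos : ∃ t : ℝ, 0 < t ∧ 0 < distFun P τ t)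
    (Y : Ω → ℝ) (hY : Measurable Y)
    (hY_exp : HasLaw Y (expMeasure 1) P)
    (hτY : IndepFun τ Y P)
    {Ω' : ℝ → Type*} [∀ r, MeasurableSpace (Ω' r)]
    (Q : ∀ r, Measure (Ω' r)) [∀ r, IsProbabilityMeasure (Q r)]
    (T : ∀ r, Ω' r → ℝ)
    (hT : ∀ r : ℝ, 0 < r → IsResetFPT P τ (resetTime Y r) (Q r) (T r))
    (A b : ℝ) (hA : 0 < A) (hb : 0 < b)
    (hF : distFun P τ ~[𝓝[>] (0 : ℝ)] fun t : ℝ => A * t ^ b) :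
    ((fun r : ℝ => successProb P τ (resetTime Y r)) ~[atTop]
      fun r : ℝ => Real.Gamma (b + 1) * A * r ^ (-b)) ∧
    ∀ m : ℕ, 1 ≤ m →
      (∀ᶠ r : ℝ in atTop, Integrable (fun ω => T r ω ^ m) (Q r)) ∧
      ((fun r : ℝ => ∫ ω, T r ω ^ m ∂(Q r)) ~[atTop]
        fun r : ℝ => (m ! : ℝ) * (1 / (A * Real.Gamma (b + 1)) * r ^ (b - 1)) ^ m) := by
  have hτ0 := ae_pos_of_distFun_zero hτ_zero
  have hp0 := tendsto_successProb hA hb hτ hY hY_exp hτY hF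
  have hG : 0 < Real.Gamma (b + 1) := Real.Gamma_pos_of_pos (by linarith)
  have hequiv : (fun r : ℝ => successProb P τ (resetTime Y r)) ~[atTop]
      fun r : ℝ => Real.Gamma (b + 1) * A * r ^ (-b) := by
    refine isEquivalent_of_tendsto_one ?_
    have h := (tendsto_rpow_mul_successProb hA hb hτ hY hY_exp hτY hF).div_const
      (Real.Gamma (b + 1) * A)
    rw [div_self (mul_pos hG hA).ne'] at h
    refine h.congr' ?_
    filter_upwards [eventually_gt_atTop 0] with r hr
    have := Real.rpow_pos_of_pos hr b
    simp only [Pi.div_apply, Real.rpow_neg hr.le]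
    field_simp
  have hmoments : ∀ᶠ r : ℝ in atTop, 0 < r ∧ 0 < successProb P τ (resetTime Y r) ∧
      ∀ m, Integrable (fun ω => T r ω ^ m) (Q r) ∧
        successProb P τ (resetTime Y r) * ∫ ω, T r ω ^ m ∂Q r =
          successProb P τ (resetTime Y r) *
            ∫ ω, (τ ω).toReal ^ m ∂P[|successEvent τ (resetTime Y r)] +
          (1 - successProb P τ (resetTime Y r)) * ∑ j ∈ Finset.range m, (m.choose j : ℝ) *
            (∫ ω, resetTime Y r ω ^ (m - j) ∂P[|resetEvent τ (resetTime Y r)]) *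
            ∫ ω, T r ω ^ j ∂Q r := by
    -- Eventually `0 < p < 1`, so conditioning on success and on reset are both nondegenerate.
    filter_upwards [eventually_gt_atTop 0, hp0.eventually_lt_const one_pos,
      eventually_successProb_pos hA hb hτ hY hY_exp hτY hF] with r hr hp1 hp
    refine ⟨hr, hp, (hT r hr).moments hτ (measurable_resetTime hY r) hτ0 ?_ (fun k => ?_) hp ?_⟩
    · filter_upwards [ae_pos_of_hasLaw_exp hY_exp] with ω hω using (div_pos hω hr).le
    · simp_rw [resetTime, div_pow]
      exact (integrable_pow_of_hasLaw_exp hY_exp k).div_const _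
    · rw [successProb_eq_one_sub hτ hY hY_exp hτY hr] at hp1
      linarith
  have hlim : ∀ m : ℕ, Tendsto (fun r : ℝ =>
      (successProb P τ (resetTime Y r) * r) ^ m * ∫ ω, T r ω ^ m ∂Q r) atTop (𝓝 (m ! : ℝ)) := by
    refine tendsto_factorial_of_recursion hp0
      (tendsto_pow_mul_integral_resetTime hA hb hτ hY hY_exp hτY hF)
      (e := fun n r => successProb P τ (resetTime Y r) ^ n * (successProb P τ (resetTime Y r) *
        (r ^ (n + 1) * ∫ ω, (τ ω).toReal ^ (n + 1) ∂P[|successEvent τ (resetTime Y r)])))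
      (fun n => ?_) (by simp) (fun n => ?_)
    · simpa using (hp0.pow n).mul
        (tendsto_mul_pow_mul_integral_toReal hA hb hτ hτ0 hY hY_exp hτY hF (n + 1))
    · filter_upwards [hmoments] with r ⟨hr, hp, hm⟩
      have h := (hm (n + 1)).2
      set p := successProb P τ (resetTime Y r)
      -- The renewal identity is multiplied by `p^n r^(n+1)`, which splits as `p^(n-j) · r^(n+1-j) ·
      -- (p r)^j` in the `j`-th term.
      have h2 : (p * r) ^ (n + 1) * ∫ ω, T r ω ^ (n + 1) ∂Q r =
          p ^ n * r ^ (n + 1) * (p * ∫ ω, T r ω ^ (n + 1) ∂Q r) := by ring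
      rw [h2, h, mul_add]
      congr 1
      · ring
      · rw [mul_left_comm, Finset.mul_sum]
        congr 1
        refine Finset.sum_congr rfl fun j hj => ?_
        have hj' : j ≤ n := Nat.lt_succ_iff.1 (Finset.mem_range.1 hj)
        have e1 : p ^ n = p ^ (n - j) * p ^ j := by rw [← pow_add, Nat.sub_add_cancel hj']
        have e2 : r ^ (n + 1) = r ^ (n + 1 - j) * r ^ j := by
          rw [← pow_add, Nat.sub_add_cancel (by omega)]
        rw [e1, e2]
        ring
  refine ⟨hequiv, fun m _ => ⟨hmoments.mono fun r h => (h.2.2 m).1, ?_⟩⟩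
  have hB : (fun r : ℝ => (successProb P τ (resetTime Y r) * r) ^ m * ∫ ω, T r ω ^ m ∂Q r)
      ~[atTop] fun _ => (m ! : ℝ) :=
    (isEquivalent_const_iff_tendsto (by positivity)).2 (hlim m)
  have hpr : (fun r : ℝ => (successProb P τ (resetTime Y r) * r) ^ m) ~[atTop]
      fun r : ℝ => (Real.Gamma (b + 1) * A * r ^ (-b) * r) ^ m :=
    (hequiv.mul IsEquivalent.refl).pow m
  -- Dividing the normalized moment by `(p r)^m`, where `p r ~ A Γ(b+1) r^(1-b)`, recovers `E[T^m]`.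
  refine ((hB.div hpr).congr_left ?_).congr_right ?_
  · filter_upwards [hmoments] with r ⟨hr, hp, _⟩
    simp only [Pi.div_apply]
    field_simp
  · filter_upwards [eventually_gt_atTop 0] with r hr
    have := Real.rpow_pos_of_pos hr b
    simp only [Pi.div_apply, Real.rpow_neg hr.le, Real.rpow_sub_one hr.ne', div_eq_mul_inv]
    simp only [← inv_pow, mul_inv, inv_inv]
    ring
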